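/- Let $n\ge 0$ and let $\sigma=\bigoplus_{i=1}^{n}\begin{pmatrix}0&1\\-1&0\end{pmatrix}$. A Gaussian channel (on $n$ modes, mapping zero-mean states to zero-mean states) is identified with a pair $(X,Y)$ of real $2n\times 2n$ matrices such that $Y\ge i(\sigma-X\sigma X^T)$, that is, the complex matrix $Y-i(\sigma-X\sigma X^T)$ is Hermitian positive semidefinite. A one-parameter semigroup of Gaussian channels is a family $(X_t,Y_t)_{t\ge 0}$ of Gaussian channels such that $t\mapsto X_t$ and $t\mapsto Y_t$ are continuous, $X_tX_s=X_{t+s}$ and $Y_{t+s}=Y_t+X_tY_sX_t^T$ for all $s,t\ge 0$, and $X_0=\mathbb 1$, $Y_0=0$. Let $X$ be a real $2n\times 2n$ matrix. The following conditions are equivalent: (i) There is a real $2n\times 2n$ matrix $Y$ such that $(X,Y)=(X_t,Y_t)$ for some one-parameter semigroup $(X_t,Y_t)_{t\ge0}$ of Gaussian channels and some $t\ge 0$. (ii) $X$ is nonsingular, and the Jordan blocks of $X$ for negative eigenvalues have even multiplicities: for every real $\lambda<0$ and every $k\ge1$, the Jordan block of size $k$ with eigenvalue $\lambda$ occurs an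 even number of times in the Jordan normal form of $X$ over $\mathbb C$. Moreover, (ii) holds if and only if $X$ has a real logarithm, i.e. $X=e^L$ for some real $2n\times 2n$ matrix $L$. -/

import Mathlib

open scoped Matrix NNReal ComplexOrder

noncomputable section

namespace GaussianSemigroup

/-- Real `2n × 2n` matrices. The coordinates are ordered as `(Q₁, P₁, …, Qₙ, Pₙ)`. -/
abbrev PhaseMatrix (n : ℕ) : Type := Matrix (Fin (2 * n)) (Fin (2 * n)) ℝ

/-- The symplectic matrix `σ = ⊕ᵢ [[0, 1], [-1, 0]]` (`n` diagonal blocks of size two). With rows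
and columns numbered from zero, row `2i` has its `1` in column `2i + 1`, and row `2i + 1` has its
`-1` in column `2i`. -/
def sigma (n : ℕ) : PhaseMatrix n :=
  Matrix.of fun a b =>
    if (a : ℕ) % 2 = 0 ∧ (b : ℕ) = a + 1 then 1
    else if (b : ℕ) % 2 = 0 ∧ (a : ℕ) = b + 1 then -1
    else 0

/-- A real matrix seen as a complex matrix. -/
def complexify {m : ℕ} (A : Matrix (Fin m) (Fin m) ℝ) : Matrix (Fin m) (Fin m) ℂ :=
  A.map Complex.ofReal

/-- `(X, Y)` is a Gaussian channel (`W_ξ ↦ W_{Xᵀξ} exp (-ξᵀYξ/2)`): the condition of complete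
positivity `Y ≥ i (σ - X σ Xᵀ)` holds in the order of complex Hermitian matrices. -/
def IsGaussianChannel {n : ℕ} (X Y : PhaseMatrix n) : Prop :=
  (complexify Y - Complex.I • complexify (sigma n - X * sigma n * Xᵀ)).PosSemidef

/-- `t ↦ (X t, Y t)`, `t ≥ 0`, is a one-parameter semigroup of Gaussian channels. -/
structure IsOneParameterSemigroup {n : ℕ} (X Y : ℝ≥0 → PhaseMatrix n) : Prop where
  isGaussianChannel : ∀ t, IsGaussianChannel (X t) (Y t)
  continuous_X : Continuous X
  continuous_Y : Continuous Y
  mul_X : ∀ t s, X t * X s = X (t + s)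
  add_Y : ∀ t s, Y (t + s) = Y t + X t * Y s * (X t)ᵀ
  zero_X : X 0 = 1
  zero_Y : Y 0 = 0

/-- `(X, Y)` is an element of some one-parameter semigroup of Gaussian channels. -/
def IsElementOfOneParameterSemigroup {n : ℕ} (X Y : PhaseMatrix n) : Prop :=
  ∃ Xf Yf : ℝ≥0 → PhaseMatrix n, IsOneParameterSemigroup Xf Yf ∧ ∃ t, Xf t = X ∧ Yf t = Y

/-- The upper Jordan block of size `k` with eigenvalue `z`. -/
def jordanBlock (k : ℕ) (z : ℂ) : Matrix (Fin k) (Fin k) ℂ :=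
  Matrix.of fun a b => if a = b then z else if (b : ℕ) = a + 1 then 1 else 0

/-- The complex matrix `A` is similar to the block diagonal matrix with diagonal blocks
`jordanBlock (size i) (eig i)`, `i : Fin r`, all of positive size; that is, the latter is a Jordan
normal form of `A`. -/
def IsJordanNormalForm {m : ℕ} (A : Matrix (Fin m) (Fin m) ℂ) {r : ℕ}
    (size : Fin r → ℕ) (eig : Fin r → ℂ) : Prop :=
  (∀ i, 0 < size i) ∧
    ∃ (P : Matrix (Fin m) (Σ i, Fin (size i)) ℂ) (Q : Matrix (Σ i, Fin (size i)) (Fin m) ℂ),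
      P * Q = 1 ∧ Q * P = 1 ∧
        A = P * Matrix.blockDiagonal' (fun i => jordanBlock (size i) (eig i)) * Q

/-- The Jordan blocks of the real matrix `X` for negative eigenvalues have even multiplicities:
in the Jordan normal form of `X` (which is unique up to the order of its blocks), the block of
size `k` with eigenvalue `z` occurs an even number of times, for every real `z < 0` and every
`k`. -/
def HasEvenNegativeJordanBlocks {m : ℕ} (X : Matrix (Fin m) (Fin m) ℝ) : Prop :=
  ∃ (r : ℕ) (size : Fin r → ℕ) (eig : Fin r → ℂ),
    IsJordanNormalForm (complexify X) size eig ∧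
      ∀ z : ℝ, z < 0 → ∀ k : ℕ, Even (Nat.card {i : Fin r // size i = k ∧ eig i = (z : ℂ)})

end GaussianSemigroup

end

/-! Both conditions are equivalent to the existence of a real logarithm.

If `X = e^L`, put `X_t = e^{tL}` and `Y_t = c ∫₀ᵗ X_s X_sᵀ ds`. The derivative of `Y_t - i(σ - X_t σ
X_tᵀ)` is `X_t (c + i(Lσ + σLᵀ)) X_tᵀ`, which is positive semidefinite for large `c`, and the
expression vanishes at `t = 0` (`exists_semigroup_of_exp`). Conversely, in a continuous semigroup
`X_{t/k}` is close to `1` for large `k`, so it has a logarithm, and `k` times that is a logarithm of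
`X_t`.

For the Jordan blocks, the numbers `dim ker (X - z)^j` are sums of `min(size, j)` over the blocks
for `z`. All multiplicities are even exactly when all these dimensions are, and for real `z` the
dimensions may be taken over `ℝ`. If `X = e^L`, then `e^{L/2}` is a real square root preserving each
kernel. On a kernel of dimension `d` the determinant `z^d` of `X` is therefore a square, so `d` is
even for `z < 0`.

Conversely, in the real primary decomposition equal components for negative eigenvalues can be
paired. A signed swap within the pairs, and the identity elsewhere, gives `M` commuting with `X`,
with `M² = -1` on the negative part. Neither `M` nor `M²X` has an eigenvalue in `(-∞, 0]`, so they
have commuting logarithms `K` and `L`, and `M⁴ = 1` gives `X = M²(M²X) = e^{2K+L}`. -/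

noncomputable section

namespace GaussianSemigroup

/-! ### Logarithms in real Banach algebras, by integration along a segment -/

section Logarithm

variable {𝔸 : Type*} [NormedRing 𝔸] [NormedAlgebra ℝ 𝔸] [CompleteSpace 𝔸]

/-- The derivative of `exp (-g)` along a curve `g` with commuting values. -/
theorem hasDerivAt_exp_neg_of_commute {g : ℝ → 𝔸} {g' : 𝔸} {t : ℝ} (hg : HasDerivAt g g' t)
    (hc : ∀ s, Commute (g t) (g s)) :
    HasDerivAt (fun s => NormedSpace.exp (-g s)) (NormedSpace.exp (-g t) * (-g')) t := by
  let : NormedAlgebra ℚ 𝔸 := NormedAlgebra.restrictScalars ℚ ℝ 𝔸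
  have h1 : HasDerivAt (fun s => -(g s - g t)) (-g') t := (hg.sub_const _).neg
  -- Commutativity gives `exp (-g s) = exp (-g t) * exp (-(g s - g t))`, so the derivative of `exp`
  -- is needed only at `0`.
  have h0 : HasFDerivAt (NormedSpace.exp : 𝔸 → 𝔸) (1 : 𝔸 →L[ℝ] 𝔸) (-(g t - g t)) := by
    rw [sub_self, neg_zero]; exact hasFDerivAt_exp_zero
  have h2 := (h0.comp_hasDerivAt t h1).const_mul (NormedSpace.exp (-g t))
  refine h2.congr_of_eventuallyEq (Filter.Eventually.of_forall fun s => ?_)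
  have : Commute (-g t) (-(g s - g t)) :=
    (((hc s).sub_right (Commute.refl _)).neg_left).neg_right
  simp only [Function.comp]
  rw [← NormedSpace.exp_add_of_commute this]
  congr 1; abel

/-- If `1 + s (x - 1)` is a unit for all `s ∈ [0, 1]`, then `x` has a logarithm that commutes with
everything that commutes with `x`. -/
theorem exists_exp_eq_of_isUnit_segment (x : 𝔸)
    (h : ∀ s ∈ Set.Icc (0 : ℝ) 1, IsUnit (1 + s • (x - 1))) :
    ∃ L : 𝔸, NormedSpace.exp L = x ∧ ∀ y, Commute x y → Commute L y := by
  let : NormedAlgebra ℚ 𝔸 := NormedAlgebra.restrictScalars ℚ ℝ 𝔸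
  -- Clamping the parameter to `[0, 1]` makes `p` invertible on all of `ℝ`, so no one-sided
  -- derivatives of the integral arise.
  let p : ℝ → 𝔸 := fun s => 1 + (Set.projIcc (0 : ℝ) 1 zero_le_one s : ℝ) • (x - 1)
  have hp : Continuous p := by
    have := continuous_projIcc (a := (0 : ℝ)) (b := 1) (h := zero_le_one)
    fun_prop
  have hu : ∀ s, IsUnit (p s) := fun s => h _ (Set.projIcc (0 : ℝ) 1 zero_le_one s).2
  let g : ℝ → 𝔸 := fun s => (x - 1) * Ring.inverse (p s)
  have hg : Continuous g := by
    refine continuous_const.mul (continuous_iff_continuousAt.2 fun s => ?_)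
    obtain ⟨u, hu⟩ := hu s
    have h1 := NormedRing.inverse_continuousAt u
    rw [hu] at h1
    exact ContinuousAt.comp (f := p) h1 hp.continuousAt
  have hgc : ∀ y, Commute x y → ∀ s, Commute (g s) y := by
    intro y hy s
    have h1 : Commute (x - 1) y := hy.sub_left (Commute.one_left y)
    refine h1.mul_left ?_
    have h2 : Commute (p s) y := (Commute.one_left y).add_left (h1.smul_left _)
    obtain ⟨u, hu⟩ := hu s
    rw [← hu, Ring.inverse_unit]
    rw [← hu] at h2
    exact h2.units_inv_left
  let G : ℝ → 𝔸 := fun s => ∫ u in (0 : ℝ)..s, g u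
  have hGc : ∀ y, Commute x y → ∀ s, Commute (G s) y := by
    intro y hy s
    have hi : IntervalIntegrable g MeasureTheory.volume 0 s := hg.intervalIntegrable _ _
    have h1 := ((ContinuousLinearMap.mul ℝ 𝔸).flip y).intervalIntegral_comp_comm hi
    have h2 := ((ContinuousLinearMap.mul ℝ 𝔸) y).intervalIntegral_comp_comm hi
    simp only [ContinuousLinearMap.flip_apply, ContinuousLinearMap.mul_apply'] at h1 h2
    change G s * y = y * G s
    rw [← h1, ← h2]
    exact intervalIntegral.integral_congr fun u _ => hgc y hy u
  have hGd : ∀ s, HasDerivAt G (g s) s := fun s =>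
    intervalIntegral.integral_hasDerivAt_right (hg.intervalIntegrable _ _)
      (hg.stronglyMeasurableAtFilter _ _) hg.continuousAt
  -- Commutation with `x` itself gives `Commute (G t) x`; a second application, with `y = G t`,
  -- gives the claim.
  have hGG : ∀ s t, Commute (G s) (G t) := fun s t =>
    hGc _ (hGc x (Commute.refl x) t).symm s
  -- `G s` should be the logarithm of `1 + s (x - 1)`, so `F` should be constant on `[0, 1]`, equal
  -- to its value `1` at `0`.
  let F : ℝ → 𝔸 := fun s => NormedSpace.exp (-G s) * (1 + s • (x - 1))
  have hF : ∀ s, HasDerivAt F (NormedSpace.exp (-G s) * (-g s) * (1 + s • (x - 1)) +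
      NormedSpace.exp (-G s) * (x - 1)) s := by
    intro s
    refine (hasDerivAt_exp_neg_of_commute (hGd s) (hGG s)).mul ?_
    simpa using ((hasDerivAt_id s).smul_const (x - 1)).const_add 1
  have hF0 : ∀ s ∈ Set.Icc (0 : ℝ) 1, HasDerivAt F 0 s := by
    intro s hs
    convert hF s using 1
    have : p s = 1 + s • (x - 1) := by
      simp only [p]; rw [Set.projIcc_of_mem zero_le_one hs]
    rw [← this, mul_assoc, neg_mul, mul_assoc, Ring.inverse_mul_cancel _ (hu s), mul_one, mul_neg, neg_add_cancel]
  have hconst := constant_of_has_deriv_right_zero (f := F) (a := 0) (b := 1)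
    (fun s hs => (hF0 s hs).continuousAt.continuousWithinAt)
    (fun s hs => (hF0 s ⟨hs.1, hs.2.le⟩).hasDerivWithinAt) 1 ⟨zero_le_one, le_rfl⟩
  have hG0 : G 0 = 0 := by simp [G]
  simp only [F, hG0, neg_zero, NormedSpace.exp_zero, one_smul, zero_smul, add_zero, one_mul,
    add_sub_cancel] at hconst
  refine ⟨G 1, ?_, fun y hy => hGc y hy 1⟩
  have h3 : NormedSpace.exp (G 1) * NormedSpace.exp (-G 1) = 1 := by
    rw [← NormedSpace.exp_add_of_commute (Commute.refl (G 1)).neg_right, add_neg_cancel,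
      NormedSpace.exp_zero]
  calc NormedSpace.exp (G 1) = NormedSpace.exp (G 1) * (NormedSpace.exp (-G 1) * x) := by
        rw [hconst, mul_one]
    _ = x := by rw [← mul_assoc, h3, one_mul]

end Logarithm

/-! ### Logarithms of real matrices and of elements of matrix semigroups -/

section MatrixLogarithm

theorem exists_matrix_exp_eq_of_isUnit_segment {m : ℕ} (A : Matrix (Fin m) (Fin m) ℝ)
    (h : ∀ s ∈ Set.Icc (0 : ℝ) 1, IsUnit (1 + s • (A - 1))) :
    ∃ L : Matrix (Fin m) (Fin m) ℝ, NormedSpace.exp L = A ∧ ∀ B, Commute A B → Commute L B :=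
  open scoped Matrix.Norms.Operator in exists_exp_eq_of_isUnit_segment A h

/-- A real matrix without eigenvalues in `(-∞, 0]` has a logarithm that commutes with everything
that commutes with the matrix. -/
theorem exists_exp_eq_of_no_nonpos_eigenvalue {m : ℕ} (A : Matrix (Fin m) (Fin m) ℝ)
    (h : ∀ z : ℝ, z ≤ 0 → ∀ v, A *ᵥ v = z • v → v = 0) :
    ∃ L : Matrix (Fin m) (Fin m) ℝ, NormedSpace.exp L = A ∧ ∀ B, Commute A B → Commute L B := by
  apply exists_matrix_exp_eq_of_isUnit_segment A
  intro s hs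
  rw [← Matrix.mulVec_injective_iff_isUnit]
  rw [← Matrix.coe_mulVecLin, ← LinearMap.ker_eq_bot, LinearMap.ker_eq_bot']
  intro v hv
  simp only [Matrix.mulVecLin_apply, Matrix.add_mulVec, Matrix.smul_mulVec,
    Matrix.sub_mulVec, Matrix.one_mulVec] at hv
  -- For `s = 0` the matrix is the identity. For `s > 0` a kernel vector is an eigenvector of `A`
  -- for `-(1 - s) / s ≤ 0`.
  rcases hs.1.eq_or_lt with rfl | hpos
  · simpa using hv
  · refine h (-((1 - s) / s)) ?_ v ?_
    · have := div_nonneg (sub_nonneg.2 hs.2) hpos.le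
      linarith
    · funext i
      have := congrFun hv i
      simp only [Pi.add_apply, Pi.smul_apply, Pi.sub_apply, smul_eq_mul, Pi.zero_apply] at this ⊢
      field_simp
      linarith

open scoped Matrix.Norms.Operator in
/-- Every element of a continuous one-parameter semigroup of real matrices has a real logarithm. -/
theorem exists_exp_eq_of_semigroup {m : ℕ} {F : ℝ≥0 → Matrix (Fin m) (Fin m) ℝ}
    (hF : Continuous F) (hmul : ∀ t s, F t * F s = F (t + s)) (h0 : F 0 = 1) (t : ℝ≥0) :
    ∃ L : Matrix (Fin m) (Fin m) ℝ, NormedSpace.exp L = F t := by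
  have hpow : ∀ (k : ℕ) s, F s ^ k = F (k * s) := by
    intro k s
    induction k with
    | zero => simp [h0]
    | succ k ih => rw [pow_succ, ih, hmul]; congr 1; push_cast; ring
  have hlim : Filter.Tendsto (fun k : ℕ => F (t / ((k : ℝ≥0) + 1))) Filter.atTop (nhds 1) := by
    rw [← h0]
    refine (hF.tendsto 0).comp ?_
    have := tendsto_one_div_add_atTop_nhds_zero_nat (𝕜 := ℝ≥0)
    simpa [div_eq_mul_inv] using this.const_mul t
  obtain ⟨k, hk⟩ : ∃ k : ℕ, ‖F (t / ((k : ℝ≥0) + 1)) - 1‖ < 1 := by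
    obtain ⟨k, hk⟩ := (hlim.eventually (Metric.ball_mem_nhds 1 one_pos)).exists
    exact ⟨k, by rwa [← dist_eq_norm]⟩
  obtain ⟨L, hL, -⟩ := exists_matrix_exp_eq_of_isUnit_segment (F (t / ((k : ℝ≥0) + 1))) (by
    intro s hs
    have h1 : ‖-(s • (F (t / ((k : ℝ≥0) + 1)) - 1))‖ < 1 := by
      rw [norm_neg, norm_smul, Real.norm_of_nonneg hs.1]
      exact (mul_le_of_le_one_left (norm_nonneg _) hs.2).trans_lt hk
    simpa using isUnit_one_sub_of_norm_lt_one h1)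
  refine ⟨(k + 1) • L, ?_⟩
  rw [Matrix.exp_nsmul, hL, hpow]
  congr 1
  push_cast
  field_simp

end MatrixLogarithm

/-! ### Complete positivity and the semigroup of a generator -/

open scoped Matrix.Norms.L2Operator MatrixOrder in
theorem exists_smul_one_add_posSemidef {m : ℕ} (H : Matrix (Fin m) (Fin m) ℂ)
    (hH : H.IsHermitian) : ∃ c : ℝ, ((c : ℂ) • 1 + H).PosSemidef := by
  have h := IsSelfAdjoint.neg_algebraMap_norm_le_self (a := H) hH
  rw [Matrix.le_iff] at h
  refine ⟨‖H‖, ?_⟩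
  have heq : ((‖H‖ : ℝ) : ℂ) • 1 + H = H - -algebraMap ℝ (Matrix (Fin m) (Fin m) ℂ) ‖H‖ := by
    rw [sub_neg_eq_add, add_comm, Algebra.algebraMap_eq_smul_one]
    rfl
  rw [heq]
  exact h

section Complexify

variable {m : ℕ} (A B : Matrix (Fin m) (Fin m) ℝ)

theorem complexify_add : complexify (A + B) = complexify A + complexify B := by
  ext; simp [complexify]

theorem complexify_sub : complexify (A - B) = complexify A - complexify B := by
  ext; simp [complexify]

theorem complexify_smul (c : ℝ) : complexify (c • A) = (c : ℂ) • complexify A := by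
  ext; simp [complexify]

theorem complexify_one : complexify (1 : Matrix (Fin m) (Fin m) ℝ) = 1 := by
  simp [complexify]

theorem complexify_mul : complexify (A * B) = complexify A * complexify B :=
  Matrix.map_mul (f := Complex.ofRealHom)

theorem complexify_conjTranspose : (complexify A)ᴴ = complexify Aᵀ := by
  ext; simp [complexify]

end Complexify

theorem sigma_transpose (n : ℕ) : (sigma n)ᵀ = -sigma n := by
  ext a b
  simp only [sigma, Matrix.transpose_apply, Matrix.of_apply, Matrix.neg_apply]
  split_ifs <;> first | omega | simp

/-- For antisymmetric `K`, the matrix `c - i K` is positive semidefinite for some `c`. -/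
theorem exists_posSemidef_of_antisymm {m : ℕ} {K : Matrix (Fin m) (Fin m) ℝ} (hK : Kᵀ = -K) :
    ∃ c : ℝ, (complexify (c • 1) - Complex.I • complexify K).PosSemidef := by
  obtain ⟨c, hc⟩ := exists_smul_one_add_posSemidef (-(Complex.I • complexify K)) (by
    rw [Matrix.IsHermitian, Matrix.conjTranspose_neg, Matrix.conjTranspose_smul,
      complexify_conjTranspose, hK]
    ext; simp [complexify])
  refine ⟨c, ?_⟩
  rwa [complexify_smul, complexify_one, sub_eq_add_neg]

/-- The quadratic form `(A, B) ↦ re ⟨x, (A - i B) x⟩` on pairs of real matrices. -/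
def pairForm {m : ℕ} (x : Fin m → ℂ) :
    Matrix (Fin m) (Fin m) ℝ × Matrix (Fin m) (Fin m) ℝ →ₗ[ℝ] ℝ where
  toFun p := (star x ⬝ᵥ ((complexify p.1 - Complex.I • complexify p.2) *ᵥ x)).re
  map_add' p q := by
    rw [← Complex.add_re, ← dotProduct_add, ← Matrix.add_mulVec, Prod.fst_add, Prod.snd_add,
      complexify_add, complexify_add, smul_add, add_sub_add_comm]
  map_smul' c p := by
    rw [Prod.smul_fst, Prod.smul_snd, complexify_smul, complexify_smul, smul_comm Complex.I,
      ← smul_sub, Matrix.smul_mulVec, dotProduct_smul, smul_eq_mul, Complex.re_ofReal_mul]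
    rfl

/-- The symmetry conditions make `A - iB` Hermitian, so its quadratic form is real and the real part
decides positivity. -/
theorem posSemidef_of_pairForm_nonneg {m : ℕ} {A B : Matrix (Fin m) (Fin m) ℝ} (hA : Aᵀ = A)
    (hB : Bᵀ = -B) (h : ∀ x, 0 ≤ pairForm x (A, B)) :
    (complexify A - Complex.I • complexify B).PosSemidef := by
  have hH : (complexify A - Complex.I • complexify B).IsHermitian := by
    rw [Matrix.IsHermitian, Matrix.conjTranspose_sub, Matrix.conjTranspose_smul,
      complexify_conjTranspose, complexify_conjTranspose, hA, hB]
    ext; simp [complexify]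
  refine .of_dotProduct_mulVec_nonneg hH fun x => ?_
  rw [Complex.le_def]
  exact ⟨h x, (hH.im_star_dotProduct_mulVec_self x).symm⟩

theorem pairForm_conj_nonneg {m : ℕ} {A B : Matrix (Fin m) (Fin m) ℝ}
    (h : (complexify A - Complex.I • complexify B).PosSemidef) (C : Matrix (Fin m) (Fin m) ℝ)
    (x : Fin m → ℂ) : 0 ≤ pairForm x (C * A * Cᵀ, C * B * Cᵀ) := by
  have h1 := (h.mul_mul_conjTranspose_same (complexify C)).re_dotProduct_nonneg x
  convert h1 using 1
  rw [complexify_conjTranspose, Matrix.mul_sub, Matrix.sub_mul, Matrix.mul_smul, Matrix.smul_mul,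
    ← complexify_mul, ← complexify_mul, ← complexify_mul, ← complexify_mul]
  rfl

/-- A continuous curve has a primitive that inherits its invariance and translation properties. -/
theorem exists_primitive {E : Type*} [NormedAddCommGroup E] [NormedSpace ℝ E] [CompleteSpace E]
    {g : ℝ → E} (hg : Continuous g) :
    ∃ Y : ℝ → E, Y 0 = 0 ∧ (∀ t, HasDerivAt Y (g t) t) ∧
      (∀ T : E →L[ℝ] E, (∀ u, T (g u) = g u) → ∀ t, T (Y t) = Y t) ∧
      ∀ (T : E →L[ℝ] E) (t : ℝ), (∀ u, g (t + u) = T (g u)) → ∀ s, Y (t + s) = Y t + T (Y s) := by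
  have hi : ∀ a b, IntervalIntegrable g MeasureTheory.volume a b := hg.intervalIntegrable
  refine ⟨fun t => ∫ u in (0 : ℝ)..t, g u, by simp, fun t => ?_, fun T hT t => ?_,
    fun T t hT s => ?_⟩
  · exact intervalIntegral.integral_hasDerivAt_right (hi _ _)
      (hg.stronglyMeasurableAtFilter _ _) hg.continuousAt
  · rw [← T.intervalIntegral_comp_comm (hi 0 t)]
    exact intervalIntegral.integral_congr fun u _ => hT u
  · rw [← T.intervalIntegral_comp_comm (hi 0 s),
      ← intervalIntegral.integral_congr (f := fun u => g (t + u)) (fun u _ => hT u),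
      intervalIntegral.integral_comp_add_left, add_zero,
      intervalIntegral.integral_add_adjacent_intervals (hi _ _) (hi _ _)]

open scoped Matrix.Norms.Operator in
/-- Every real generator `L` gives a one-parameter semigroup of Gaussian channels with
`X t = exp (t L)` and `Y t = c ∫₀ᵗ X s (X s)ᵀ ds`. -/
theorem exists_semigroup_of_exp {n : ℕ} (L : PhaseMatrix n) :
    ∃ X Y : ℝ≥0 → PhaseMatrix n, IsOneParameterSemigroup X Y ∧ X 1 = NormedSpace.exp L := by
  -- This `K` is the derivative at `t = 0` of `σ - X_t σ X_tᵀ`.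
  obtain ⟨c, hc⟩ := exists_posSemidef_of_antisymm (K := -(L * sigma n + sigma n * Lᵀ)) (by
    simp only [Matrix.transpose_neg, Matrix.transpose_add, Matrix.transpose_mul, sigma_transpose,
      Matrix.transpose_transpose]
    noncomm_ring)
  let E : ℝ → PhaseMatrix n := fun t => NormedSpace.exp (t • L)
  have hEd : ∀ t, HasDerivAt E (E t * L) t := fun t => hasDerivAt_exp_smul_const L t
  have hEc : Continuous E := continuous_iff_continuousAt.2 fun t => (hEd t).continuousAt
  have hEadd : ∀ t s, E (t + s) = E t * E s := fun t s => by
    simp only [E]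
    rw [add_smul, Matrix.exp_add_of_commute]
    exact ((Commute.refl L).smul_left t).smul_right s
  have hE0 : E 0 = 1 := by simp [E]
  let T : PhaseMatrix n →L[ℝ] PhaseMatrix n :=
    (Matrix.transposeLinearEquiv (Fin (2 * n)) (Fin (2 * n)) ℝ ℝ).toLinearMap.toContinuousLinearMap
  have hTd : ∀ t, HasDerivAt (fun s => (E s)ᵀ) (E t * L)ᵀ t := fun t =>
    T.hasFDerivAt.comp_hasDerivAt t (hEd t)
  have hTc : Continuous fun t => (E t)ᵀ := T.continuous.comp hEc
  let g : ℝ → PhaseMatrix n := fun t => E t * (c • 1) * (E t)ᵀ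
  have hg : Continuous g := (hEc.mul continuous_const).mul hTc
  have hgadd : ∀ t s, g (t + s) = E t * g s * (E t)ᵀ := fun t s => by
    simp only [g, hEadd, Matrix.transpose_mul, Matrix.mul_assoc]
  obtain ⟨Y, hY0, hYd, hYfix, hYshift⟩ := exists_primitive hg
  have hYc : Continuous Y := continuous_iff_continuousAt.2 fun t => (hYd t).continuousAt
  have hYsymm : ∀ t, (Y t)ᵀ = Y t := hYfix T fun u => by
    change (g u)ᵀ = g u
    simp [g, Matrix.transpose_mul]
  have hYadd : ∀ t s, Y (t + s) = Y t + E t * Y s * (E t)ᵀ := fun t s =>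
    hYshift (((ContinuousLinearMap.mul ℝ _).flip (E t)ᵀ).comp (ContinuousLinearMap.mul ℝ _ (E t)))
      t (hgadd t) s
  let D : ℝ → PhaseMatrix n := fun t => sigma n - E t * sigma n * (E t)ᵀ
  have hDd : ∀ t, HasDerivAt D (E t * (-(L * sigma n + sigma n * Lᵀ)) * (E t)ᵀ) t := by
    intro t
    have := (((hEd t).mul_const (sigma n)).mul (hTd t)).const_sub (sigma n)
    have heq : E t * (-(L * sigma n + sigma n * Lᵀ)) * (E t)ᵀ =
        -(E t * L * sigma n * (E t)ᵀ + E t * sigma n * (E t * L)ᵀ) := by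
      rw [Matrix.transpose_mul]
      noncomm_ring
    rw [heq]
    exact this
  have hD0 : D 0 = 0 := by simp [D, hE0]
  have hDanti : ∀ t, (D t)ᵀ = -D t := fun t => by
    simp only [D, Matrix.transpose_sub, Matrix.transpose_mul, Matrix.transpose_transpose,
      sigma_transpose]
    noncomm_ring
  have hform : ∀ x, ∀ t, 0 ≤ t → 0 ≤ pairForm x (Y t, D t) := by
    intro x
    have hd : ∀ t, HasDerivAt (fun s => pairForm x (Y s, D s))
        (pairForm x (g t, E t * (-(L * sigma n + sigma n * Lᵀ)) * (E t)ᵀ)) t := fun t =>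
      (pairForm x).toContinuousLinearMap.hasFDerivAt.comp_hasDerivAt t ((hYd t).prodMk (hDd t))
    -- The derivative is the form of `c - iK` conjugated by `E t`; nonnegativity for `t ≥ 0` then
    -- follows from the value `0` at `t = 0`.
    have hmono : Monotone fun s => pairForm x (Y s, D s) :=
      monotone_of_hasDerivAt_nonneg hd fun t => pairForm_conj_nonneg hc (E t) x
    intro t ht
    have h1 := hmono ht
    have h2 : pairForm x (Y 0, D 0) = 0 := by
      rw [hY0, hD0]; exact map_zero _
    exact h2.symm.le.trans h1
  refine ⟨fun t => E t, fun t => Y t, ?_, ?_⟩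
  · constructor
    · intro t
      exact posSemidef_of_pairForm_nonneg (hYsymm t) (hDanti t) fun x => hform x t t.2
    · exact hEc.comp NNReal.continuous_coe
    · exact hYc.comp NNReal.continuous_coe
    · intro t s
      rw [NNReal.coe_add, hEadd]
    · intro t s
      rw [NNReal.coe_add, hYadd]
    · exact hE0
    · exact hY0
  · simp [E]

/-! ### Primary decomposition and kernel dimensions -/

section PrimaryDecomposition

open Polynomial

variable {K V : Type*} [Field K] [AddCommGroup V] [Module K V]

/-- The product over `i` of the `K[X]`-modules `K[X] / (p i ^ e i)`. -/
abbrev PrimaryProduct {r : ℕ} (p : Fin r → K[X]) (e : Fin r → ℕ) : Type _ :=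
  ∀ i, K[X] ⧸ Ideal.span {p i ^ e i}

/-- Primary decomposition of an endomorphism of a finite-dimensional vector space. -/
theorem exists_equiv_primaryProduct [FiniteDimensional K V] (f : Module.End K V) :
    ∃ (r : ℕ) (p : Fin r → K[X]) (e : Fin r → ℕ) (φ : V ≃ₗ[K] PrimaryProduct p e),
      (∀ i, (p i).Monic) ∧ (∀ i, Irreducible (p i)) ∧ (∀ i, 0 < e i) ∧
        ∀ v, φ (f v) = (X : K[X]) • φ v := by
  classical
  obtain ⟨ι, _, p, hp, e, ⟨ψ⟩⟩ :=
    Module.equiv_directSum_of_isTorsion (R := K[X]) (M := Module.AEval' f)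
      (Module.AEval.isTorsion_of_finiteDimensional K V f)
  -- Components with exponent zero are zero modules and are dropped.
  let J := {i : ι // 0 < e i}
  let σ : J ≃ Fin (Fintype.card J) := Fintype.equivFin J
  let M : ι → Type _ := fun i => K[X] ⧸ Ideal.span {p i ^ e i}
  let ψ₁ : Module.AEval' f ≃ₗ[K[X]] ∀ i, M i :=
    ψ.trans (DirectSum.linearEquivFunOnFintype K[X] ι M)
  have hsub : ∀ i, ¬ 0 < e i → Subsingleton (M i) := by
    intro i hi
    have : e i = 0 := by omega
    refine Ideal.Quotient.subsingleton_iff.2 ?_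
    rw [this, pow_zero, Ideal.span_singleton_one]
  let ψ₂ : (∀ i, M i) ≃ₗ[K[X]] ∀ j : J, M j :=
    { toFun := fun v j => v j
      map_add' := fun _ _ => rfl
      map_smul' := fun _ _ => rfl
      invFun := fun w i => if h : 0 < e i then w ⟨i, h⟩ else 0
      left_inv := fun v => by
        funext i
        by_cases h : 0 < e i
        · simp [h]
        · have := hsub i h
          exact Subsingleton.elim _ _
      right_inv := fun w => by
        funext j
        exact dif_pos j.2 }
  let ψ₃ : (∀ j : J, M j) ≃ₗ[K[X]] ∀ a, M (σ.symm a) :=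
    LinearEquiv.piCongrLeft' K[X] (fun j : J => M j) σ
  -- Monic generators make associated primes equal, so a prime associated to `X - C z` is `X - C z`
  -- itself.
  let q : Fin (Fintype.card J) → K[X] := fun a => normalize (p (σ.symm a))
  let k : Fin (Fintype.card J) → ℕ := fun a => e (σ.symm a)
  have hspan : ∀ a, Ideal.span {p (σ.symm a) ^ e (σ.symm a)} = Ideal.span {q a ^ k a} := by
    intro a
    exact Ideal.span_singleton_eq_span_singleton.2 ((associated_normalize _).pow_pow)
  let ψ₄ : (∀ a, M (σ.symm a)) ≃ₗ[K[X]] PrimaryProduct q k :=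
    LinearEquiv.piCongrRight fun a => Submodule.quotEquivOfEq _ _ (hspan a)
  let Ψ := ((ψ₁.trans ψ₂).trans ψ₃).trans ψ₄
  refine ⟨_, q, k, (Module.AEval'.of f).trans (Ψ.restrictScalars K), fun a => ?_, fun a => ?_,
    fun a => (σ.symm a).2, fun v => ?_⟩
  · exact Polynomial.monic_normalize (hp _).ne_zero
  · exact (associated_normalize _).irreducible (hp _)
  · simp only [LinearEquiv.trans_apply, LinearEquiv.restrictScalars_apply]
    rw [← map_smul, Module.AEval'.X_smul_of]

theorem eq_zero_of_smul_eq_zero_of_isCoprime {g q : K[X]} (h : IsCoprime g q)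
    {x : K[X] ⧸ Ideal.span {g}} (hx : q • x = 0) : x = 0 := by
  obtain ⟨y, rfl⟩ := Ideal.Quotient.mk_surjective x
  have h1 : Ideal.Quotient.mk (Ideal.span {g}) (q * y) = 0 := hx
  rw [Ideal.Quotient.eq_zero_iff_mem, Ideal.mem_span_singleton] at h1 ⊢
  exact h.dvd_of_dvd_mul_left h1

theorem isCoprime_X_sub_C_of_ne {p : K[X]} (hm : p.Monic) (hp : Irreducible p) {z : K}
    (h : p ≠ X - C z) : IsCoprime p (X - C z) := by
  rw [hp.coprime_iff_not_dvd]
  exact fun hd => h (eq_of_monic_of_associated hm (monic_X_sub_C z)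
    (hp.associated_of_dvd (irreducible_X_sub_C z) hd))

/-- By rank-nullity the kernel has the dimension of the cokernel, which is the quotient of `K[X]` by
the ideal generated by `(X - z)^e` and `(X - z)^j`, that is, by `(X - z)^(min e j)`. -/
theorem finrank_ker_lsmul_pow {p : K[X]} {z : K} (hp : p = X - C z) (e j : ℕ) :
    Module.finrank K (LinearMap.ker (Algebra.lsmul K K (K[X] ⧸ Ideal.span {p ^ e})
      ((X - C z) ^ j))) = min e j := by
  subst hp
  set g : K[X] := (X - C z) ^ e with hg
  have hgm : g.Monic := (monic_X_sub_C z).pow e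
  have hgfin : Module.Finite K (K[X] ⧸ Ideal.span {g}) := hgm.finite_quotient
  let T := Algebra.lsmul K K (K[X] ⧸ Ideal.span {g}) ((X - C z) ^ j)
  have hdim : Module.finrank K (K[X] ⧸ Ideal.span {g}) = e := by
    rw [finrank_quotient_span_eq_natDegree, hg, natDegree_pow, natDegree_X_sub_C, mul_one]
  have h1 := T.finrank_range_add_finrank_ker
  have h2 := (LinearMap.range T).finrank_quotient_add_finrank
  have h3 : Module.finrank K ((K[X] ⧸ Ideal.span {g}) ⧸ LinearMap.range T) = min e j := by
    let π : K[X] →ₗ[K] (K[X] ⧸ Ideal.span {g}) ⧸ LinearMap.range T :=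
      (LinearMap.range T).mkQ ∘ₗ (Ideal.Quotient.mkₐ K (Ideal.span {g})).toLinearMap
    have hπ : Function.Surjective π :=
      (Submodule.mkQ_surjective _).comp Ideal.Quotient.mk_surjective
    have hker : LinearMap.ker π = (Ideal.span {(X - C z) ^ min e j}).restrictScalars K := by
      ext y
      rw [LinearMap.mem_ker, Submodule.restrictScalars_mem, Ideal.mem_span_singleton]
      change Submodule.Quotient.mk _ = _ ↔ _
      rw [Submodule.Quotient.mk_eq_zero]
      constructor
      · rintro ⟨w, hw⟩
        obtain ⟨w, rfl⟩ := Ideal.Quotient.mk_surjective w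
        have hw' : Ideal.Quotient.mk (Ideal.span {g}) ((X - C z) ^ j * w) =
          Ideal.Quotient.mk (Ideal.span {g}) y := hw
        rw [Ideal.Quotient.eq, Ideal.mem_span_singleton] at hw'
        have h4 : (X - C z) ^ min e j ∣ (X - C z) ^ j * w - y :=
          (pow_dvd_pow _ (min_le_left _ _)).trans hw'
        exact (dvd_sub_right ((pow_dvd_pow _ (min_le_right _ _)).mul_right w)).1 h4
      · rintro ⟨w, rfl⟩
        rcases le_total e j with h | h
        · rw [min_eq_left h]
          have : (Ideal.Quotient.mkₐ K (Ideal.span {g})).toLinearMap (g * w) = 0 := by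
            change Ideal.Quotient.mk (Ideal.span {g}) _ = 0
            rw [Ideal.Quotient.eq_zero_iff_mem]
            exact Ideal.mul_mem_right _ _ (Ideal.mem_span_singleton_self g)
          rw [this]
          exact Submodule.zero_mem _
        · rw [min_eq_right h]
          exact ⟨Ideal.Quotient.mk _ w, rfl⟩
    rw [← (π.quotKerEquivOfSurjective hπ).finrank_eq, hker]
    have := finrank_quotient_span_eq_natDegree (K := K) (f := (X - C z) ^ min e j)
    rw [natDegree_pow, natDegree_X_sub_C, mul_one] at this
    exact this
  change Module.finrank K (LinearMap.ker T) = _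
  omega

/-- The dimension of the kernel of `(f - z) ^ j` in terms of the primary decomposition. -/
theorem finrank_ker_pow_eq_sum [DecidableEq K[X]] {f : Module.End K V} {r : ℕ} {p : Fin r → K[X]}
    {e : Fin r → ℕ}
    (φ : V ≃ₗ[K] PrimaryProduct p e) (hm : ∀ i, (p i).Monic) (hp : ∀ i, Irreducible (p i))
    (hφ : ∀ v, φ (f v) = (X : K[X]) • φ v) (z : K) (j : ℕ) :
    Module.finrank K (LinearMap.ker ((f - algebraMap K _ z) ^ j)) =
      ∑ i with p i = X - C z, min (e i) j := by
  have hpow : ∀ v, φ (((f - algebraMap K _ z) ^ j) v) = ((X - C z) ^ j : K[X]) • φ v := by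
    induction j with
    | zero => simp
    | succ j ih =>
      intro v
      rw [pow_succ, Module.End.mul_apply, ih, pow_succ, mul_smul]
      congr 1
      have hz : φ (algebraMap K (Module.End K V) z v) = (C z : K[X]) • φ v := by
        rw [Module.algebraMap_end_apply, map_smul, ← Polynomial.algebraMap_eq]
        exact (algebraMap_smul K[X] z (φ v)).symm
      rw [LinearMap.sub_apply, map_sub, hφ, hz]
      exact (sub_smul (X : K[X]) (C z) (φ v)).symm
  let T : ∀ i, Module.End K (K[X] ⧸ Ideal.span {p i ^ e i}) := fun i =>
    Algebra.lsmul K K (K[X] ⧸ Ideal.span {p i ^ e i}) ((X - C z) ^ j)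
  let Φ : LinearMap.ker ((f - algebraMap K _ z) ^ j) ≃ₗ[K] ∀ i, LinearMap.ker (T i) :=
    { toFun := fun v i => ⟨φ v i, by
        have := hpow v
        rw [LinearMap.mem_ker.1 v.2, map_zero] at this
        exact (congrFun this i).symm⟩
      map_add' := fun _ _ => by ext; simp
      map_smul' := fun _ _ => by ext; simp
      invFun := fun w => ⟨φ.symm fun i => (w i : _), by
        rw [LinearMap.mem_ker, ← φ.map_eq_zero_iff, hpow, φ.apply_symm_apply]
        funext i
        exact (w i).2⟩
      left_inv := fun v => by ext; simp
      right_inv := fun w => by ext; simp }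
  have hfin : ∀ i, Module.Finite K (K[X] ⧸ Ideal.span {p i ^ e i}) := fun i =>
    ((hm i).pow _).finite_quotient
  have hfree : ∀ i, Module.Free K (LinearMap.ker (T i)) := fun i => Module.Free.of_divisionRing K _
  have hfin' : ∀ i, Module.Finite K (LinearMap.ker (T i)) := fun i =>
    FiniteDimensional.finiteDimensional_submodule _
  rw [Φ.finrank_eq, Module.finrank_pi_fintype, Finset.sum_filter]
  refine Finset.sum_congr rfl fun i _ => ?_
  split_ifs with h
  · exact finrank_ker_lsmul_pow h (e i) j
  -- For any other prime, `(X - z)^j` is coprime to `p i ^ e i` and acts injectively.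
  · have hker : LinearMap.ker (T i) = ⊥ := LinearMap.ker_eq_bot'.2 fun x hx =>
      eq_zero_of_smul_eq_zero_of_isCoprime (isCoprime_X_sub_C_of_ne (hm i) (hp i) h).pow hx
    rw [hker, finrank_bot]

end PrimaryDecomposition

/-! ### Parity of multiplicities -/

section Parity

/-- All multiplicities of a finite family of positive integers are even if and only if all sums of
truncations are even. -/
theorem even_multiplicity_iff {ι : Type*} (s : Finset ι) (e : ι → ℕ) (he : ∀ i, 0 < e i) :
    (∀ k, Even (s.filter fun i => e i = k).card) ↔ ∀ j, Even (∑ i ∈ s, min (e i) j) := by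
  classical
  constructor
  · intro h j
    rw [Finset.sum_comp (fun k => min k j) e]
    refine Finset.even_sum _ fun k _ => ?_
    rw [smul_eq_mul]
    exact (h k).mul_right _
  · intro h k
    rcases Nat.eq_zero_or_pos k with rfl | hk
    · rw [Finset.filter_false_of_mem fun i _ => (he i).ne']
      simp
    -- The second difference of `j ↦ min e j` at `k ≥ 1` is `-1` if `e = k` and `0` otherwise; it is
    -- written additively because of truncated subtraction.
    · have key : (s.filter fun i => e i = k).card + (∑ i ∈ s, min (e i) (k + 1)) +
          ∑ i ∈ s, min (e i) (k - 1) = 2 * ∑ i ∈ s, min (e i) k := by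
        rw [Finset.card_filter, ← Finset.sum_add_distrib, ← Finset.sum_add_distrib, Finset.mul_sum]
        refine Finset.sum_congr rfl fun i _ => ?_
        split_ifs <;> omega
      obtain ⟨a, ha⟩ := h (k + 1)
      obtain ⟨b, hb⟩ := h (k - 1)
      rw [Nat.even_iff]
      omega

end Parity

/-! ### Jordan blocks as cyclic modules -/

section JordanBlock

open Polynomial

/-- The Jordan block acts like multiplication by `X` on `ℂ[X] / (X - z) ^ k`. -/
theorem exists_equiv_jordanBlock (k : ℕ) (z : ℂ) :
    ∃ β : (Fin k → ℂ) ≃ₗ[ℂ] ℂ[X] ⧸ Ideal.span {(X - C z) ^ k},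
      ∀ v, β (jordanBlock k z *ᵥ v) = (X : ℂ[X]) • β v := by
  -- The exponents are reversed because an upper block sends basis vector `b` to `z` times itself
  -- plus vector `b - 1`: multiplication by `X - z` must lower the index. For `b = 0` it yields `(X
  -- - z)^k`, zero in the quotient.
  let u₀ : Fin k → ℂ[X] := fun a => (X - C z) ^ (a.rev : ℕ)
  let β₀ : (Fin k → ℂ) →ₗ[ℂ] ℂ[X] := Fintype.linearCombination ℂ u₀
  let π : ℂ[X] →ₗ[ℂ] ℂ[X] ⧸ Ideal.span {(X - C z) ^ k} :=
    (Ideal.Quotient.mkₐ ℂ (Ideal.span {(X - C z) ^ k})).toLinearMap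
  have hπ : ∀ P, π P = 0 ↔ (X - C z) ^ k ∣ P := fun P => by
    rw [← Ideal.mem_span_singleton]
    exact Ideal.Quotient.eq_zero_iff_mem
  have hβ₀ : ∀ v, β₀ v = ∑ a, v a • u₀ a := fun v => Fintype.linearCombination_apply ..
  have hinj : Function.Injective (π ∘ₗ β₀) := by
    rw [← LinearMap.ker_eq_bot, LinearMap.ker_eq_bot']
    intro v hv
    have hdvd : (X - C z) ^ k ∣ β₀ v := (hπ _).1 hv
    have hmon : ((X - C z) ^ k).Monic := (monic_X_sub_C z).pow k
    have hdeg : (β₀ v).degree < ((X - C z) ^ k).degree := by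
      rw [degree_pow, degree_X_sub_C, nsmul_one, hβ₀]
      refine (degree_sum_le _ _).trans_lt ((Finset.sup_lt_iff (WithBot.bot_lt_coe _)).2 ?_)
      intro a _
      refine (degree_smul_le _ _).trans_lt ?_
      rw [degree_pow, degree_X_sub_C, nsmul_one]
      exact_mod_cast a.rev.2
    have hzero : β₀ v = 0 := by
      by_contra hne
      exact not_lt_of_ge (degree_le_of_dvd hdvd hne) hdeg
    -- A Taylor shift turns powers of `X - z` into monomials, whose coefficients can be read off.
    have hT : ∑ a : Fin k, C (v a) * X ^ (a.rev : ℕ) = 0 := by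
      have h1 := congrArg (taylor z) hzero
      rw [hβ₀, map_sum, map_zero] at h1
      rw [← h1]
      refine Finset.sum_congr rfl fun a _ => ?_
      rw [map_smul, taylor_pow, map_sub, taylor_X, taylor_C, add_sub_cancel_right, smul_eq_C_mul]
    funext a
    have h2 := congrArg (fun P => coeff P (a.rev : ℕ)) hT
    simp only [finsetSum_coeff, coeff_C_mul, coeff_X_pow, coeff_zero] at h2
    rw [Finset.sum_eq_single a] at h2
    · simpa using h2
    · intro b _ hb
      rw [if_neg, mul_zero]
      intro h3
      exact hb (Fin.rev_injective (Fin.ext h3.symm))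
    · simp
  have hfin : Module.Finite ℂ (ℂ[X] ⧸ Ideal.span {(X - C z) ^ k}) :=
    ((monic_X_sub_C z).pow k).finite_quotient
  have hdim : Module.finrank ℂ (Fin k → ℂ) =
      Module.finrank ℂ (ℂ[X] ⧸ Ideal.span {(X - C z) ^ k}) := by
    rw [finrank_quotient_span_eq_natDegree, natDegree_pow, natDegree_X_sub_C, mul_one,
      Module.finrank_fin_fun]
  refine ⟨LinearMap.linearEquivOfInjective (π ∘ₗ β₀) hinj hdim, fun v => ?_⟩
  simp only [LinearMap.linearEquivOfInjective_apply, LinearMap.comp_apply]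
  have hcol : ∀ b, π (X * u₀ b) = ∑ a, jordanBlock k z a b • π (u₀ a) := by
    intro b
    have h1 : X * u₀ b = z • u₀ b + (X - C z) ^ ((b.rev : ℕ) + 1) := by
      simp only [u₀, smul_eq_C_mul]
      ring
    rw [h1, map_add, map_smul]
    have hJ : ∀ a, jordanBlock k z a b • π (u₀ a) =
        (if a = b then z • π (u₀ b) else 0) + (if (b : ℕ) = a + 1 then π (u₀ a) else 0) := by
      intro a
      simp only [jordanBlock, Matrix.of_apply]
      split_ifs with h2 h3 h4
      · subst h2; omega
      · subst h2; simp
      · simp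
      · simp
    rw [Finset.sum_congr rfl fun a _ => hJ a, Finset.sum_add_distrib,
      Finset.sum_ite_eq' Finset.univ b, if_pos (Finset.mem_univ _)]
    congr 1
    rcases Nat.eq_zero_or_pos (b : ℕ) with h0 | h0
    · rw [Finset.sum_eq_zero fun a _ => if_neg (by omega), hπ]
      refine pow_dvd_pow _ ?_
      rw [Fin.val_rev]; omega
    · rw [Finset.sum_eq_single (⟨b - 1, by omega⟩ : Fin k)]
      · rw [if_pos (by simp; omega)]
        simp only [u₀, Fin.val_rev]
        congr 2
        omega
      · intro a _ ha
        rw [if_neg]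
        intro h2
        exact ha (Fin.ext (by simp; omega))
      · simp
  have hsmul : (X : ℂ[X]) • π (β₀ v) = π (X * β₀ v) := rfl
  have hL : π (β₀ (jordanBlock k z *ᵥ v)) =
      ∑ a, ∑ b, (jordanBlock k z a b * v b) • π (u₀ a) := by
    rw [hβ₀, map_sum]
    refine Finset.sum_congr rfl fun a _ => ?_
    rw [map_smul, ← Finset.sum_smul]
    rfl
  have hR : π (X * β₀ v) = ∑ b, ∑ a, (jordanBlock k z a b * v b) • π (u₀ a) := by
    rw [hβ₀, Finset.mul_sum, map_sum]
    refine Finset.sum_congr rfl fun b _ => ?_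
    rw [mul_smul_comm, map_smul, hcol, Finset.smul_sum]
    exact Finset.sum_congr rfl fun a _ => by rw [smul_smul, mul_comm]
  rw [hsmul, hL, hR, Finset.sum_comm]

theorem blockDiagonal'_mulVec_apply {r : ℕ} {size : Fin r → ℕ} {R : Type*} [CommSemiring R]
    (M : ∀ i, Matrix (Fin (size i)) (Fin (size i)) R) (w : (Σ i, Fin (size i)) → R) (i : Fin r) :
    (fun a => (Matrix.blockDiagonal' M *ᵥ w) ⟨i, a⟩) = M i *ᵥ fun a => w ⟨i, a⟩ := by
  funext a
  simp only [Matrix.mulVec, dotProduct, Fintype.sum_sigma]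
  rw [Finset.sum_eq_single i]
  · simp [Matrix.blockDiagonal'_apply_eq]
  · intro j _ hj
    exact Finset.sum_eq_zero fun b _ => by
      rw [Matrix.blockDiagonal'_apply_ne _ _ _ hj.symm, zero_mul]
  · simp

/-- A Jordan normal form is the same as a primary decomposition with linear primes. -/
theorem isJordanNormalForm_iff {m : ℕ} (A : Matrix (Fin m) (Fin m) ℂ) {r : ℕ}
    (size : Fin r → ℕ) (eig : Fin r → ℂ) :
    IsJordanNormalForm A size eig ↔ (∀ i, 0 < size i) ∧
      ∃ φ : (Fin m → ℂ) ≃ₗ[ℂ] PrimaryProduct (fun i => X - C (eig i)) size,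
        ∀ v, φ (A *ᵥ v) = (X : ℂ[X]) • φ v := by
  choose β hβ using fun i => exists_equiv_jordanBlock (size i) (eig i)
  set D := Matrix.blockDiagonal' fun i => jordanBlock (size i) (eig i) with hD
  let Θ : ((Σ i, Fin (size i)) → ℂ) ≃ₗ[ℂ] PrimaryProduct (fun i => X - C (eig i)) size :=
    (LinearEquiv.piCurry ℂ fun i (_ : Fin (size i)) => ℂ).trans (LinearEquiv.piCongrRight β)
  have hΘ : ∀ w, Θ (D *ᵥ w) = (X : ℂ[X]) • Θ w := by
    intro w
    funext i
    change β i (fun a => (D *ᵥ w) ⟨i, a⟩) = (X : ℂ[X]) • β i fun a => w ⟨i, a⟩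
    rw [hD, blockDiagonal'_mulVec_apply, hβ]
  refine and_congr_right fun _ => ⟨?_, ?_⟩
  · rintro ⟨P, Q, hPQ, hQP, rfl⟩
    refine ⟨(Matrix.toLin'OfInv hPQ hQP).trans Θ, fun v => ?_⟩
    have h1 : ∀ v, (Matrix.toLin'OfInv hPQ hQP).trans Θ v = Θ (Q *ᵥ v) := fun v => rfl
    rw [h1, h1, ← hΘ, Matrix.mulVec_mulVec,
      Matrix.mulVec_mulVec, ← Matrix.mul_assoc, ← Matrix.mul_assoc, hQP, Matrix.one_mul]
  · rintro ⟨φ, hφ⟩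
    let ψ := φ.trans Θ.symm
    have hψ : ∀ v, ψ (A *ᵥ v) = D *ᵥ ψ v := by
      intro v
      apply Θ.injective
      rw [hΘ]
      simp only [ψ, LinearEquiv.trans_apply, LinearEquiv.apply_symm_apply, hφ]
    refine ⟨LinearMap.toMatrix' ψ.symm.toLinearMap, LinearMap.toMatrix' ψ.toLinearMap, ?_, ?_, ?_⟩
    · rw [← LinearMap.toMatrix'_comp, LinearEquiv.symm_comp, LinearMap.toMatrix'_id]
    · rw [← LinearMap.toMatrix'_comp, LinearEquiv.comp_symm, LinearMap.toMatrix'_id]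
    · apply Matrix.toLin'.injective
      refine LinearMap.ext fun v => ?_
      simp only [Matrix.toLin'_mul, Matrix.toLin'_toMatrix', LinearMap.comp_apply,
        LinearEquiv.coe_coe, Matrix.toLin'_apply]
      rw [← hψ, LinearEquiv.symm_apply_apply]

end JordanBlock

/-! ### Block parities as parities of real kernel dimensions -/

open Polynomial

theorem exists_isJordanNormalForm {m : ℕ} (A : Matrix (Fin m) (Fin m) ℂ) :
    ∃ (r : ℕ) (size : Fin r → ℕ) (eig : Fin r → ℂ), IsJordanNormalForm A size eig := by
  obtain ⟨r, p, e, φ, hm, hp, he, hφ⟩ := exists_equiv_primaryProduct (Matrix.toLin' A)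
  have hlin : ∀ i, ∃ z, p i = X - C z := by
    intro i
    have hdeg : (p i).natDegree = 1 :=
      natDegree_eq_of_degree_eq_some (IsAlgClosed.degree_eq_one_of_irreducible ℂ (hp i))
    refine ⟨-(p i).coeff 0, ?_⟩
    rw [map_neg, sub_neg_eq_add]
    exact (hm i).eq_X_add_C hdeg
  choose eig heig using hlin
  obtain rfl : p = fun i => X - C (eig i) := funext heig
  exact ⟨r, e, eig, (isJordanNormalForm_iff A e eig).2 ⟨he, φ, hφ⟩⟩

/-- The right side does not mention the chosen Jordan form, so the parity condition is independent
of that choice without appeal to uniqueness. -/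
theorem IsJordanNormalForm.even_card_iff {m : ℕ} {A : Matrix (Fin m) (Fin m) ℂ} {r : ℕ}
    {size : Fin r → ℕ} {eig : Fin r → ℂ} (h : IsJordanNormalForm A size eig) (z : ℂ) :
    (∀ k : ℕ, Even (Nat.card {i : Fin r // size i = k ∧ eig i = z})) ↔
      ∀ j : ℕ, Even (Module.finrank ℂ (LinearMap.ker
        ((Matrix.toLin' A - algebraMap ℂ (Module.End ℂ (Fin m → ℂ)) z) ^ j))) := by
  classical
  obtain ⟨hpos, φ, hφ⟩ := (isJordanNormalForm_iff A size eig).1 h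
  have h1 := fun j => finrank_ker_pow_eq_sum (f := Matrix.toLin' A) φ
    (fun i => monic_X_sub_C (eig i)) (fun i => irreducible_X_sub_C (eig i)) hφ z j
  have h2 : (Finset.univ.filter fun i => (X - C (eig i) : ℂ[X]) = X - C z) =
      Finset.univ.filter fun i => eig i = z := by
    refine Finset.filter_congr fun i _ => ?_
    rw [sub_right_inj, C_inj]
  simp_rw [h1, h2]
  rw [← even_multiplicity_iff _ _ hpos]
  refine forall_congr' fun k => ?_
  rw [Nat.card_eq_fintype_card, Fintype.card_subtype, Finset.filter_filter]
  simp_rw [and_comm]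

/-- Real and imaginary parts split the complex kernel into two copies of the real one, while its
real dimension is twice the complex one. -/
theorem finrank_ker_complexify {m : ℕ} (B : Matrix (Fin m) (Fin m) ℝ) :
    Module.finrank ℂ (LinearMap.ker (Matrix.toLin' (complexify B))) =
      Module.finrank ℝ (LinearMap.ker (Matrix.toLin' B)) := by
  have hre : ∀ (v : Fin m → ℂ) i, ((complexify B *ᵥ v) i).re = (B *ᵥ fun a => (v a).re) i := by
    intro v i
    simp [complexify, Matrix.mulVec, dotProduct]
  have him : ∀ (v : Fin m → ℂ) i, ((complexify B *ᵥ v) i).im = (B *ᵥ fun a => (v a).im) i := by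
    intro v i
    simp [complexify, Matrix.mulVec, dotProduct]
  let Φ : LinearMap.ker (Matrix.toLin' (complexify B)) ≃ₗ[ℝ]
      LinearMap.ker (Matrix.toLin' B) × LinearMap.ker (Matrix.toLin' B) :=
    { toFun := fun v => (⟨fun a => (v.1 a).re, by
          have hv := v.2
          rw [LinearMap.mem_ker, Matrix.toLin'_apply] at hv ⊢
          funext i
          rw [← hre, hv]; rfl⟩, ⟨fun a => (v.1 a).im, by
          have hv := v.2
          rw [LinearMap.mem_ker, Matrix.toLin'_apply] at hv ⊢
          funext i
          rw [← him, hv]; rfl⟩)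
      map_add' := fun v w => by ext <;> simp
      map_smul' := fun c v => by ext <;> simp
      invFun := fun w => ⟨fun a => ⟨w.1.1 a, w.2.1 a⟩, by
          have h1 := w.1.2
          have h2 := w.2.2
          rw [LinearMap.mem_ker, Matrix.toLin'_apply] at h1 h2 ⊢
          funext i
          apply Complex.ext
          · rw [hre]; exact congrFun h1 i
          · rw [him]; exact congrFun h2 i⟩
      left_inv := fun v => rfl
      right_inv := fun w => rfl }
  have h1 := Φ.finrank_eq
  rw [Module.finrank_prod, finrank_real_of_complex] at h1
  omega

theorem finrank_ker_pow_complexify {m : ℕ} (A : Matrix (Fin m) (Fin m) ℝ) (z : ℝ) (j : ℕ) :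
    Module.finrank ℂ (LinearMap.ker ((Matrix.toLin' (complexify A) -
      algebraMap ℂ (Module.End ℂ (Fin m → ℂ)) z) ^ j)) =
    Module.finrank ℝ (LinearMap.ker ((Matrix.toLin' A -
      algebraMap ℝ (Module.End ℝ (Fin m → ℝ)) z) ^ j)) := by
  have key : ∀ {F : Type} [Field F] (M : Matrix (Fin m) (Fin m) F) (w : F),
      (Matrix.toLin' M - algebraMap F (Module.End F (Fin m → F)) w) ^ j =
        Matrix.toLin' ((M - w • 1) ^ j) := by
    intro F _ M w
    rw [Matrix.toLin'_pow, map_sub, map_smul, Matrix.toLin'_one, Algebra.algebraMap_eq_smul_one]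
    rfl
  have hpow : complexify ((A - z • 1) ^ j) = (complexify A - (z : ℂ) • 1) ^ j := by
    have h1 : ∀ (M : Matrix (Fin m) (Fin m) ℝ), complexify (M ^ j) = complexify M ^ j := by
      intro M
      exact map_pow (Complex.ofRealHom.mapMatrix (m := Fin m)) M j
    rw [h1, complexify_sub, complexify_smul, complexify_one]
  rw [key, key, ← hpow, finrank_ker_complexify]

/-- The parity condition on Jordan blocks, expressed over `ℝ`. -/
theorem hasEvenNegativeJordanBlocks_iff {m : ℕ} (A : Matrix (Fin m) (Fin m) ℝ) :
    HasEvenNegativeJordanBlocks A ↔ ∀ z : ℝ, z < 0 → ∀ j : ℕ,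
      Even (Module.finrank ℝ (LinearMap.ker ((Matrix.toLin' A -
        algebraMap ℝ (Module.End ℝ (Fin m → ℝ)) z) ^ j))) := by
  simp_rw [← finrank_ker_pow_complexify]
  constructor
  · rintro ⟨r, size, eig, hJ, h⟩ z hz
    exact (hJ.even_card_iff z).1 (h z hz)
  · intro h
    obtain ⟨r, size, eig, hJ⟩ := exists_isJordanNormalForm (complexify A)
    exact ⟨r, size, eig, hJ, fun z hz => (hJ.even_card_iff z).2 (h z hz)⟩

/-! ### Real logarithms force even kernel dimensions -/

/-- An endomorphism of a real space that is a negative number plus a nilpotent, and a square, acts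
on an even-dimensional space. -/
theorem even_finrank_of_sq {V : Type*} [AddCommGroup V] [Module ℝ V] [FiniteDimensional ℝ V]
    {f g : Module.End ℝ V} {z : ℝ} (hz : z < 0) (hg : g * g = f)
    (hf : IsNilpotent (f - algebraMap ℝ (Module.End ℝ V) z)) : Even (Module.finrank ℝ V) := by
  have h1 := hf.charpoly_eq_X_pow_finrank
  have h2 : LinearMap.det f = z ^ Module.finrank ℝ V := by
    have h3 := LinearMap.det_eq_sign_charpoly_coeff f
    have h4 : f.charpoly = (X - C z) ^ Module.finrank ℝ V := by
      have h5 := LinearMap.charpoly_sub_smul (f - algebraMap ℝ (Module.End ℝ V) z) (-z)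
      rw [h1, X_pow_comp, map_neg, ← sub_eq_add_neg] at h5
      rw [← h5]
      congr 1
      rw [Algebra.algebraMap_eq_smul_one, neg_smul, sub_neg_eq_add, sub_add_cancel]
    rw [h3, h4, coeff_zero_eq_eval_zero, eval_pow, eval_sub, eval_X, eval_C, zero_sub, ← mul_pow]
    simp
  -- Now `(det g)² = z ^ d`, which would be negative for odd `d`.
  rw [← hg, map_mul] at h2
  by_contra hodd
  rw [Nat.not_even_iff_odd] at hodd
  have := hodd.pow_neg hz
  nlinarith [mul_self_nonneg (LinearMap.det g)]

/-- The real square root `exp (L / 2)` commutes with `exp L`, hence preserves the kernel, where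
`even_finrank_of_sq` applies. -/
theorem even_finrank_ker_pow_of_exp {m : ℕ} (L : Matrix (Fin m) (Fin m) ℝ) {z : ℝ} (hz : z < 0)
    (j : ℕ) :
    Even (Module.finrank ℝ (LinearMap.ker ((Matrix.toLin' (NormedSpace.exp L) -
        algebraMap ℝ (Module.End ℝ (Fin m → ℝ)) z) ^ j))) := by
  let R : Matrix (Fin m) (Fin m) ℝ := NormedSpace.exp ((1 / 2 : ℝ) • L)
  have hR : R * R = NormedSpace.exp L := by
    rw [← Matrix.exp_add_of_commute _ _ (Commute.refl _), ← add_smul]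
    norm_num
  set f := Matrix.toLin' (NormedSpace.exp L) with hf
  set g := Matrix.toLin' R with hg'
  have hg : g * g = f := by
    rw [hf, hg', ← hR, Matrix.toLin'_mul]; rfl
  have hcomm : Commute g ((f - algebraMap ℝ (Module.End ℝ (Fin m → ℝ)) z) ^ j) := by
    refine Commute.pow_right (Commute.sub_right ?_ ?_) j
    · rw [← hg]; exact (Commute.refl g).mul_right (Commute.refl g)
    · exact (Algebra.commutes z g).symm
  set N := (f - algebraMap ℝ (Module.End ℝ (Fin m → ℝ)) z) with hN
  have hgW : ∀ v ∈ LinearMap.ker (N ^ j), g v ∈ LinearMap.ker (N ^ j) := by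
    intro v hv
    rw [LinearMap.mem_ker] at hv ⊢
    rw [← Module.End.mul_apply, ← hcomm.eq, Module.End.mul_apply, hv, map_zero]
  have hfW : ∀ v ∈ LinearMap.ker (N ^ j), f v ∈ LinearMap.ker (N ^ j) := by
    intro v hv
    rw [← hg]
    exact hgW _ (hgW _ hv)
  refine even_finrank_of_sq (f := f.restrict hfW) (g := g.restrict hgW) hz ?_ ⟨j, ?_⟩
  · ext v
    simp [← hg]
  · have h1 : ∀ (k : ℕ) (v : LinearMap.ker (N ^ j)),
        ((((f.restrict hfW) - algebraMap ℝ _ z) ^ k) v : Fin m → ℝ) = (N ^ k) v := by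
      intro k
      induction k with
      | zero => simp
      | succ k ih =>
        intro v
        rw [pow_succ, Module.End.mul_apply, ih, pow_succ, Module.End.mul_apply]
        rfl
    ext1 v
    apply Subtype.ext
    rw [h1]
    exact v.2

/-! ### Construction of a real logarithm -/

/-- If the fibers of `key` on `S` have even cardinalities, then the elements of `S` can be
paired within the fibers, with opposite signs in every pair. -/
theorem exists_signed_involution {ι κ : Type*} [Finite ι] (S : ι → Prop) (key : ι → κ)
    (h : ∀ c, Even (Nat.card {i // S i ∧ key i = c})) :
    ∃ (τ : ι → ι) (s : ι → ℝ), ∀ i, S i →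
      S (τ i) ∧ key (τ i) = key i ∧ τ (τ i) = i ∧ s (τ i) = -s i ∧ s i * s i = 1 := by
  classical
  have hfib : ∀ c, ∃ (τ : {i // S i ∧ key i = c} → {i // S i ∧ key i = c})
      (s : {i // S i ∧ key i = c} → ℝ),
      ∀ x, τ (τ x) = x ∧ s (τ x) = -s x ∧ s x * s x = 1 := by
    intro c
    obtain ⟨k, hk⟩ := h c
    -- An even fiber is cut into two halves of equal size; `τ` exchanges them and `s` is `1` on one
    -- and `-1` on the other.
    let ε : {i // S i ∧ key i = c} ≃ Fin k ⊕ Fin k :=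
      (Finite.equivFinOfCardEq hk).trans finSumFinEquiv.symm
    refine ⟨fun x => ε.symm (ε x).swap, fun x => Sum.elim (fun _ => 1) (fun _ => -1) (ε x),
      fun x => ?_⟩
    simp only [Equiv.apply_symm_apply, Sum.swap_swap, Equiv.symm_apply_apply, true_and]
    rcases ε x with a | a <;> simp
  choose τ s hτs using hfib
  let τ' : ι → ι := fun i => if hi : S i then τ (key i) ⟨i, hi, rfl⟩ else i
  let s' : ι → ℝ := fun i => if hi : S i then s (key i) ⟨i, hi, rfl⟩ else 0
  have hτ' : ∀ c (x : {i // S i ∧ key i = c}), τ' x = τ c x := by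
    rintro _ ⟨i, hi, rfl⟩
    exact dif_pos hi
  have hs' : ∀ c (x : {i // S i ∧ key i = c}), s' x = s c x := by
    rintro _ ⟨i, hi, rfl⟩
    exact dif_pos hi
  refine ⟨τ', s', fun i hi => ?_⟩
  let x : {j // S j ∧ key j = key i} := ⟨i, hi, rfl⟩
  have h1 : τ' i = τ (key i) x := hτ' _ x
  have h2 := hτs (key i) x
  have h3 : s' i = s (key i) x := hs' _ x
  rw [h1, hτ', hs', h2.1, h2.2.1, h3]
  exact ⟨(τ (key i) x).2.1, (τ (key i) x).2.2, rfl, rfl, h2.2.2⟩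

/-- The identification of `K[X] / (g)` and `K[X] / (g')` for `g = g'`, and zero otherwise. -/
def quotCast {K : Type*} [Field K] (g g' : K[X]) :
    (K[X] ⧸ Ideal.span {g}) →ₗ[K[X]] K[X] ⧸ Ideal.span {g'} :=
  open scoped Classical in
  if h : g = g' then (Submodule.quotEquivOfEq _ _ (by rw [h])).toLinearMap else 0

theorem quotCast_self {K : Type*} [Field K] (g : K[X]) (x : K[X] ⧸ Ideal.span {g}) :
    quotCast g g x = x := by
  obtain ⟨y, rfl⟩ := Ideal.Quotient.mk_surjective x
  rw [quotCast, dif_pos rfl]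
  rfl

theorem quotCast_quotCast {K : Type*} [Field K] {g g' g'' : K[X]} (h : g = g') (h' : g' = g'')
    (x : K[X] ⧸ Ideal.span {g}) : quotCast g' g'' (quotCast g g' x) = quotCast g g'' x := by
  subst h h'
  rw [quotCast_self]

/-- If the primary components in `S` come in pairs, then there is a `K[X]`-linear automorphism of
the product whose square is `-1` on the components in `S`, and which is `1` on the others. -/
theorem exists_structure_of_involution {r : ℕ} {p : Fin r → ℝ[X]} {e : Fin r → ℕ}
    (S : Fin r → Prop) {τ : Fin r → Fin r} {s : Fin r → ℝ}
    (h : ∀ i, S i → S (τ i) ∧ (p (τ i), e (τ i)) = (p i, e i) ∧ τ (τ i) = i ∧ s (τ i) = -s i ∧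
      s i * s i = 1) :
    ∃ J : PrimaryProduct p e →ₗ[ℝ[X]] PrimaryProduct p e,
      (∀ w i, S i → J (J w) i = -w i) ∧ ∀ w i, ¬S i → J w i = w i := by
  classical
  let g : Fin r → ℝ[X] := fun i => p i ^ e i
  have hg : ∀ i, S i → g (τ i) = g i := by
    intro i hi
    have := (h i hi).2.1
    rw [Prod.mk.injEq] at this
    simp only [g, this.1, this.2]
  -- On `S` this is `(J w)_i = s_i w_{τ i}`, so `J²` acts by `s_i s_{τ i} = -s_i² = -1`.
  let J : PrimaryProduct p e →ₗ[ℝ[X]] PrimaryProduct p e := LinearMap.pi fun i =>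
    if S i then (C (s i) : ℝ[X]) • (quotCast (g (τ i)) (g i)) ∘ₗ LinearMap.proj (τ i)
    else LinearMap.proj i
  have hJ : ∀ w i, S i → J w i = (C (s i) : ℝ[X]) • quotCast (g (τ i)) (g i) (w (τ i)) := by
    intro w i hi
    simp only [J, LinearMap.pi_apply, if_pos hi]
    rfl
  refine ⟨J, fun w i hi => ?_, fun w i hi => ?_⟩
  · obtain ⟨h1, -, h3, h4, h5⟩ := h i hi
    have hcast : ∀ k, k = i → quotCast (g k) (g i) (w k) = w i := by
      rintro k rfl
      exact quotCast_self _ _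
    rw [hJ _ _ hi, hJ _ _ h1, map_smul, quotCast_quotCast (hg _ h1) (hg _ hi), hcast _ h3, h4,
      smul_smul, ← C_mul, mul_neg, h5]
    simp
  · simp only [J, LinearMap.pi_apply, if_neg hi]
    rfl

/-- A nonsingular real matrix whose kernels `ker (A - z) ^ j` have even dimensions for `z < 0` has
a real logarithm. -/
theorem exists_exp_eq_of_even_finrank {m : ℕ} (A : Matrix (Fin m) (Fin m) ℝ) (hdet : A.det ≠ 0)
    (heven : ∀ z : ℝ, z < 0 → ∀ j : ℕ, Even (Module.finrank ℝ (LinearMap.ker ((Matrix.toLin' A -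
        algebraMap ℝ (Module.End ℝ (Fin m → ℝ)) z) ^ j)))) :
    ∃ L : Matrix (Fin m) (Fin m) ℝ, NormedSpace.exp L = A := by
  classical
  obtain ⟨r, p, e, φ, hm, hp, he, hφ⟩ := exists_equiv_primaryProduct (Matrix.toLin' A)
  let S : Fin r → Prop := fun i => ∃ z : ℝ, z < 0 ∧ p i = X - C z
  have hcard : ∀ c : ℝ[X] × ℕ, Even (Nat.card {i // S i ∧ (p i, e i) = c}) := by
    rintro ⟨q, k⟩
    by_cases hq : ∃ z : ℝ, z < 0 ∧ q = X - C z
    · obtain ⟨z, hz, rfl⟩ := hq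
      have h1 := heven z hz
      simp_rw [finrank_ker_pow_eq_sum φ hm hp hφ z] at h1
      have h2 := (even_multiplicity_iff _ e he).2 h1 k
      rw [Finset.filter_filter] at h2
      rw [Nat.card_eq_fintype_card, Fintype.card_subtype]
      convert h2 using 2
      refine Finset.filter_congr fun i _ => ?_
      rw [Prod.mk.injEq]
      exact ⟨fun h => h.2, fun h => ⟨⟨z, hz, h.1⟩, h⟩⟩
    · have : IsEmpty {i // S i ∧ (p i, e i) = (q, k)} := by
        refine ⟨?_⟩
        rintro ⟨i, ⟨z, hz, hi⟩, hc⟩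
        rw [Prod.mk.injEq] at hc
        exact hq ⟨z, hz, hc.1 ▸ hi⟩
      rw [Nat.card_of_isEmpty]
      exact Even.zero
  obtain ⟨τ, s, hτ⟩ := exists_signed_involution S (fun i => (p i, e i)) hcard
  obtain ⟨J, hJS, hJn⟩ := exists_structure_of_involution (p := p) (e := e) S hτ
  have hJJn : ∀ w i, ¬S i → J (J w) i = w i := fun w i hi => by rw [hJn _ _ hi, hJn _ _ hi]
  let M : Matrix (Fin m) (Fin m) ℝ := LinearMap.toMatrix'
    (φ.symm.toLinearMap ∘ₗ J.restrictScalars ℝ ∘ₗ φ.toLinearMap)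
  have hM : ∀ v, φ (M *ᵥ v) = J (φ v) := by
    intro v
    simp only [M]
    rw [LinearMap.toMatrix'_mulVec]
    exact φ.apply_symm_apply _
  have hA : ∀ v, φ (A *ᵥ v) = (X : ℝ[X]) • φ v := fun v => by
    rw [← hφ, Matrix.toLin'_apply]
  have hext : ∀ B C : Matrix (Fin m) (Fin m) ℝ, (∀ v, φ (B *ᵥ v) = φ (C *ᵥ v)) → B = C :=
    fun B C h => Matrix.toLin'.injective (LinearMap.ext fun v => φ.injective (h v))
  have hAM : Commute A M := hext _ _ fun v => by
    rw [← Matrix.mulVec_mulVec, ← Matrix.mulVec_mulVec, hA, hM, hM, hA, map_smul]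
  have hM4 : M * M * (M * M) = 1 := hext _ _ fun v => by
    simp only [← Matrix.mulVec_mulVec, hM, Matrix.one_mulVec]
    funext i
    by_cases hi : S i
    · rw [hJS _ _ hi, hJS _ _ hi, neg_neg]
    · rw [hJJn _ _ hi, hJJn _ _ hi]
  have hzero : ∀ (c : ℝ) (hc : c ≠ 0) (i : Fin r) (x : ℝ[X] ⧸ Ideal.span {p i ^ e i}),
      c • x = 0 → x = 0 := fun c hc i x h => (smul_eq_zero.1 h).resolve_left hc
  -- A real eigenvalue `z` of `M` would satisfy `z² = -1` on a nonzero component in `S` and `z = 1`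
  -- on one outside; neither is possible for `z ≤ 0`.
  obtain ⟨K, hK, hKc⟩ := exists_exp_eq_of_no_nonpos_eigenvalue M (by
    intro z hz v hv
    rw [← φ.map_eq_zero_iff]
    have h1 : J (φ v) = z • φ v := by rw [← hM, hv, map_smul]
    funext i
    by_cases hi : S i
    · have h2 := hJS (φ v) i hi
      rw [h1, LinearMap.map_smul_of_tower, h1, Pi.smul_apply, Pi.smul_apply] at h2
      refine hzero (z * z + 1) (add_pos_of_nonneg_of_pos (mul_self_nonneg z) one_pos).ne' i _ ?_
      rw [add_smul, mul_smul, h2, one_smul, neg_add_cancel]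
    · have h2 := hJn (φ v) i hi
      rw [h1, Pi.smul_apply] at h2
      refine hzero (1 - z) (by linarith) i _ ?_
      rw [sub_smul, h2, one_smul, sub_self])
  -- `M²A` acts as `-X` on components in `S` and as `X` on the others. An eigenvalue `z < 0` would
  -- make `X` act as `-z > 0` on a component whose prime is `X - y` with `y < 0`, or as `z` on one
  -- whose prime is not `X - z`; coprimality excludes both.
  obtain ⟨L, hL, hLc⟩ := exists_exp_eq_of_no_nonpos_eigenvalue (M * M * A) (by
    intro z hz v hv
    have hinj : A *ᵥ v = 0 → v = 0 := fun h =>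
      by_contra fun hne => hdet (Matrix.exists_mulVec_eq_zero_iff.1 ⟨v, hne, h⟩)
    rcases hz.eq_or_lt with rfl | hneg
    · apply hinj
      calc A *ᵥ v = (M * M * (M * M)) *ᵥ (A *ᵥ v) := by rw [hM4, Matrix.one_mulVec]
        _ = (M * M) *ᵥ ((M * M * A) *ᵥ v) := by simp only [Matrix.mulVec_mulVec, Matrix.mul_assoc]
        _ = 0 := by rw [hv, zero_smul, Matrix.mulVec_zero]
    · rw [← φ.map_eq_zero_iff]
      have h1 : J (J ((X : ℝ[X]) • φ v)) = z • φ v := by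
        rw [← hA, ← hM, ← hM, ← map_smul, ← hv]
        simp only [Matrix.mulVec_mulVec, Matrix.mul_assoc]
      have hC : ∀ (c : ℝ) i, (C c : ℝ[X]) • φ v i = c • φ v i := fun c i =>
        algebraMap_smul ℝ[X] c (φ v i)
      funext i
      have h2 := congrFun h1 i
      by_cases hi : S i
      · rw [hJS _ _ hi] at h2
        obtain ⟨y, hy, hpy⟩ := hi
        have hne : p i ≠ X - C (-z) := by
          rw [hpy]
          intro h
          rw [sub_right_inj, C_inj] at h
          linarith
        refine eq_zero_of_smul_eq_zero_of_isCoprime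
          (isCoprime_X_sub_C_of_ne (hm i) (hp i) hne).pow_left ?_
        rw [sub_smul, hC, neg_smul, sub_neg_eq_add]
        exact neg_eq_iff_add_eq_zero.1 h2
      · rw [hJJn _ _ hi] at h2
        refine eq_zero_of_smul_eq_zero_of_isCoprime
          (isCoprime_X_sub_C_of_ne (hm i) (hp i) fun h => hi ⟨z, hneg, h⟩).pow_left ?_
        rw [sub_smul, hC, sub_eq_zero]
        exact h2)
  have hKM : Commute K M := hKc M (Commute.refl M)
  have hKA : Commute K A := hKc A hAM.symm
  have hLK : Commute L K := hLc K (((hKM.mul_right hKM).mul_right hKA).symm)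
  refine ⟨K + K + L, ?_⟩
  rw [Matrix.exp_add_of_commute _ _ (hLK.symm.add_left hLK.symm),
    Matrix.exp_add_of_commute _ _ (Commute.refl K), hK, hL, ← Matrix.mul_assoc, hM4,
    Matrix.one_mul]

end GaussianSemigroup
end

/-! ### The two equivalences -/

theorem mainTheorem3 (n : ℕ) (X : GaussianSemigroup.PhaseMatrix n) :
    ((∃ Y : GaussianSemigroup.PhaseMatrix n,
        GaussianSemigroup.IsElementOfOneParameterSemigroup X Y) ↔
      (X.det ≠ 0 ∧ GaussianSemigroup.HasEvenNegativeJordanBlocks X)) ∧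
    ((X.det ≠ 0 ∧ GaussianSemigroup.HasEvenNegativeJordanBlocks X) ↔
      ∃ L : GaussianSemigroup.PhaseMatrix n, NormedSpace.exp L = X) := by
  have hlog : (X.det ≠ 0 ∧ GaussianSemigroup.HasEvenNegativeJordanBlocks X) ↔
      ∃ L : GaussianSemigroup.PhaseMatrix n, NormedSpace.exp L = X := by
    rw [GaussianSemigroup.hasEvenNegativeJordanBlocks_iff]
    constructor
    · rintro ⟨hdet, heven⟩
      exact GaussianSemigroup.exists_exp_eq_of_even_finrank X hdet heven
    · rintro ⟨L, rfl⟩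
      exact ⟨((Matrix.isUnit_iff_isUnit_det _).1 (Matrix.isUnit_exp L)).ne_zero,
        fun z hz j => GaussianSemigroup.even_finrank_ker_pow_of_exp L hz j⟩
  refine ⟨?_, hlog⟩
  rw [hlog]
  constructor
  · rintro ⟨Y, Xf, Yf, hsemi, t, rfl, -⟩
    exact GaussianSemigroup.exists_exp_eq_of_semigroup hsemi.continuous_X hsemi.mul_X
      hsemi.zero_X t
  · rintro ⟨L, rfl⟩
    obtain ⟨Xf, Yf, hsemi, h1⟩ := GaussianSemigroup.exists_semigroup_of_exp L
    exact ⟨Yf 1, Xf, Yf, hsemi, 1, h1, rfl⟩
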